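/- For $K>1$, $\theta\in(-\pi/2,\pi/2]$ and $c\in\mathbb{C}$ let $$H_{K,\theta,c}(z)=\left[\left(\frac{K+1}{2}\right)z+e^{2i\theta}\left(\frac{K-1}{2}\right)\overline{z}\right]^2+c\qquad(z\in\mathbb{C}).$$ For $f:\mathbb{C}\to\mathbb{C}$, with iterates $f^n$, let $I(f)=\{z\in\mathbb{C}: f^n(z)\to\infty\}$ be its escaping set and $BO(f)=\{z\in\mathbb{C}:\text{there is } M>0 \text{ with } |f^n(z)|\le M \text{ for all } n\in\mathbb{N}\}$ its bounded orbit set, and let $\mathcal{M}_{K,\theta}=\{c\in\mathbb{C}: 0\in BO(H_{K,\theta,c})\}$. A periodic point of period $n$ of $f$ is a solution of $f^n(z)=z$ ($n$ need not be the minimal period). A Cantor set is a totally disconnected, compact, perfect set. **Theorem 1.3.** Let $K>1$, $\theta\in(-\pi/2,\pi/2]$ and $c\in\mathbb{C}\setminus\mathcal{M}_{K,\theta}$. Suppose there exists an integer $n\ge 1$ such that $H_{K,\theta,c}$ has at least $2^n+1$ periodic points of period $n$. Then the boundary $\partial I(H_{K,\theta,c})$ (in $\mathbb{C}$) is not a Cantor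 set. -/

import Mathlib

namespace StretchQuad

/-- The map `H_{K,θ,c}(z) = [((K+1)/2) z + e^{2iθ} ((K-1)/2) z̄]² + c` of the complex plane. -/
noncomputable def H (K θ : ℝ) (c : ℂ) (z : ℂ) : ℂ :=
  ((((K : ℂ) + 1) / 2) * z
    + Complex.exp (2 * Complex.I * (θ : ℂ)) * (((K : ℂ) - 1) / 2) * (starRingEnd ℂ) z) ^ 2 + c

/-- The escaping set `I(f)`: the points whose forward orbit tends to `∞`. -/
def escapingSet (f : ℂ → ℂ) : Set ℂ :=
  {z | Filter.Tendsto (fun n : ℕ => f^[n] z) Filter.atTop (Bornology.cobounded ℂ)}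

/-- The bounded orbit set `BO(f)`. -/
def boundedOrbitSet (f : ℂ → ℂ) : Set ℂ :=
  {z | ∃ M : ℝ, 0 < M ∧ ∀ n : ℕ, ‖f^[n] z‖ ≤ M}

/-- The Mandelbrot set `M_{K,θ}`: the parameters `c` for which the orbit of `0` under `H_{K,θ,c}`
is bounded. -/
def mandelbrotSet (K θ : ℝ) : Set ℂ :=
  {c | (0 : ℂ) ∈ boundedOrbitSet (H K θ c)}

/-- A Cantor set in the plane: a totally disconnected, compact, perfect set. (`Perfect` means closed
and without isolated points. Non-emptiness is not demanded, so that the negation of this notion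
is the stronger one.) -/
structure IsCantorSet (S : Set ℂ) : Prop where
  isTotallyDisconnected : IsTotallyDisconnected S
  isCompact : IsCompact S
  perfect : Perfect S

end StretchQuad

open Set Filter Topology Function

/-! Suppose the boundary of the escaping set is totally disconnected. A nonempty bounded open set
never has such a frontier (`not_isTotallyDisconnected_frontier`), so the compact bounded orbit set
has empty interior and is itself totally disconnected. Since the critical orbit escapes, take the
first level set omitting `c`. It is connected, because the earlier ones contain the critical value,
and it does not separate `c` from infinity, by a maximum principle for open maps. It therefore
carries a branch of the square root of `w - c` (`exists_level_sqrt`), hence two global inverse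
branches. Nested images along a symbol sequence shrink to a connected set of bounded orbits, thus to
at most one point: itineraries are injective (`itinerary_injOn`). Period `n` makes the itinerary
`n`-periodic, leaving at most `2 ^ n` points. -/

/-! ### Plane topology: connectedness and continuous logarithms -/

/-- A decreasing intersection of compact preconnected sets is preconnected. -/
theorem IsPreconnected.iInter_of_antitone_compact {X : Type*} [TopologicalSpace X] [T2Space X]
    {K : ℕ → Set X} (hK : Antitone K) (hc : ∀ n, IsCompact (K n))
    (hp : ∀ n, IsPreconnected (K n)) : IsPreconnected (⋂ n, K n) := by
  have hcl : IsClosed (⋂ n, K n) := isClosed_iInter fun n => (hc n).isClosed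
  have hI : IsCompact (⋂ n, K n) := (hc 0).of_isClosed_subset hcl (iInter_subset _ _)
  rw [isPreconnected_iff_subset_of_fully_disjoint_closed hcl]
  intro a b ha hb hab hd
  obtain ⟨u, v, hu, hv, hau, hbv, huv⟩ := SeparatedNhds.of_isCompact_isCompact
    (hI.inter_right ha) (hI.inter_right hb) (hd.mono inter_subset_right inter_subset_right)
  have hsub : ⋂ n, K n ⊆ u ∪ v := fun x hx =>
    (hab hx).imp (fun h => hau ⟨hx, h⟩) (fun h => hbv ⟨hx, h⟩)
  obtain ⟨n, hn⟩ := exists_subset_nhds_of_isCompact hK.directed_ge hc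
    fun x hx => (hu.union hv).mem_nhds (hsub hx)
  have hle := iInter_subset K n
  rcases isPreconnected_iff_subset_of_disjoint.1 (hp n) u v hu hv hn
    (by rw [huv.inter_eq, inter_empty]) with h | h
  · refine Or.inl fun x hx => (hab hx).resolve_right fun hxb => ?_
    exact huv.le_bot ⟨h (hle hx), hbv ⟨hx, hxb⟩⟩
  · refine Or.inr fun x hx => (hab hx).resolve_left fun hxa => ?_
    exact huv.le_bot ⟨hau ⟨hx, hxa⟩, h (hle hx)⟩

/-- A continuous nonvanishing function on a totally disconnected compact space has a continuous
logarithm. -/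
theorem exists_continuous_log_of_totallyDisconnected {X : Type*} [TopologicalSpace X]
    [TotallyDisconnectedSpace X] [T2Space X] [CompactSpace X] {f : X → ℂ} (hf : Continuous f)
    (h0 : ∀ x, f x ≠ 0) : ∃ L : X → ℂ, Continuous L ∧ ∀ x, Complex.exp (L x) = f x := by
  let f' : C(X, {z : ℂ // z ≠ 0}) := ⟨fun x => ⟨f x, h0 x⟩, by fun_prop⟩
  -- A finite-valued continuous `k ∘ g` that is `S`-close to `f` has a trivial logarithm, and the
  -- principal one handles the quotient.
  let S : Set ({z : ℂ // z ≠ 0} × {z : ℂ // z ≠ 0}) :=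
    {p | (p.1 : ℂ) / p.2 ∈ Complex.slitPlane}
  have hSo : IsOpen S := by
    refine Complex.isOpen_slitPlane.preimage (Continuous.div (by fun_prop) (by fun_prop) ?_)
    exact fun p => p.2.2
  have hS : S ∈ 𝓝ˢ (diagonal _) := by
    refine hSo.mem_nhdsSet.2 ?_
    rintro ⟨x, y⟩ hxy
    obtain rfl : x = y := hxy
    simp [S, x.2]
  obtain ⟨n, g, k, hg, hgk⟩ :=
    ContinuousMap.exists_finite_approximation_of_mem_nhds_diagonal f' hS
  have hk : Continuous fun x => ((k (g x) : {z : ℂ // z ≠ 0}) : ℂ) :=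
    (continuous_of_discreteTopology (f := fun i => ((k i : {z : ℂ // z ≠ 0}) : ℂ))).comp hg
  have hlk : Continuous fun x => Complex.log ((k (g x) : {z : ℂ // z ≠ 0}) : ℂ) :=
    (continuous_of_discreteTopology
      (f := fun i => Complex.log ((k i : {z : ℂ // z ≠ 0}) : ℂ))).comp hg
  refine ⟨fun x => Complex.log (f x / (k (g x) : {z : ℂ // z ≠ 0}))
    + Complex.log ((k (g x) : {z : ℂ // z ≠ 0}) : ℂ), ?_, fun x => ?_⟩
  · exact ((hf.div hk fun x => (k (g x)).2).clog hgk).add hlk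
  · have := (k (g x)).2
    rw [Complex.exp_add, Complex.exp_log (div_ne_zero (h0 x) this), Complex.exp_log this,
      div_mul_cancel₀ _ this]

/-- The identity has no continuous logarithm on a circle around the origin. -/
theorem not_exists_continuous_log_circle {r : ℝ} (hr : 0 < r) {L : ℂ → ℂ} (hL : Continuous L)
    (h : ∀ z : ℂ, ‖z‖ = r → Complex.exp (L z) = z) : False := by
  let γ : ℝ → ℂ := fun t => r * Complex.exp (t * Complex.I)
  have hγ : Continuous γ := by fun_prop
  have hγn : ∀ t, ‖γ t‖ = r := fun t => by
    simp [γ, Complex.norm_exp_ofReal_mul_I, abs_of_pos hr]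
  have hr' : (r : ℂ) ≠ 0 := by exact_mod_cast hr.ne'
  -- `φ` is a logarithm of the constant `r`, so `ψ` is integer-valued, yet it drops by 1 over one
  -- turn.
  let φ : ℝ → ℂ := fun t => L (γ t) - t * Complex.I
  have hφ : ∀ t, Complex.exp (φ t) = r := fun t => by
    simp only [φ, Complex.exp_sub, h _ (hγn t), γ]
    exact mul_div_cancel_right₀ _ (Complex.exp_ne_zero _)
  have hφc : Continuous φ := by fun_prop
  let ψ : ℝ → ℝ := fun t => ((φ t - φ 0) / (2 * Real.pi * Complex.I)).re
  have hψ : Continuous ψ := Complex.continuous_re.comp ((hφc.sub continuous_const).div_const _)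
  have hint : ∀ t, ∃ n : ℤ, ψ t = n := fun t => by
    obtain ⟨n, hn⟩ := Complex.exp_eq_exp_iff_exists_int.1 ((hφ t).trans (hφ 0).symm)
    refine ⟨n, ?_⟩
    simp only [ψ, hn, add_sub_cancel_left]
    rw [mul_div_cancel_right₀ _ Complex.two_pi_I_ne_zero]
    simp
  have h0 : ψ 0 = 0 := by simp [ψ]
  have h1 : ψ (2 * Real.pi) = -1 := by
    have hγ1 : γ (2 * Real.pi) = γ 0 := by simp [γ, Complex.exp_two_pi_mul_I]
    have : φ (2 * Real.pi) - φ 0 = -(2 * Real.pi * Complex.I) := by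
      simp only [φ, hγ1]; push_cast; ring
    simp only [ψ, this, neg_div, div_self Complex.two_pi_I_ne_zero]
    simp
  obtain ⟨t, -, ht⟩ := intermediate_value_uIcc (a := 0) (b := 2 * Real.pi) hψ.continuousOn
    (show (-1 / 2 : ℝ) ∈ uIcc (ψ 0) (ψ (2 * Real.pi)) by
      rw [h0, h1, mem_uIcc]; right; norm_num)
  obtain ⟨n, hn⟩ := hint t
  have h2 : (2 * n : ℝ) = -1 := by rw [← hn, ht]; norm_num
  have h3 : 2 * n = -1 := by exact_mod_cast h2
  lia

/-- A nonempty bounded open subset of the plane has a frontier that is not totally disconnected. -/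
theorem not_isTotallyDisconnected_frontier {U : Set ℂ} (hU : IsOpen U) (hne : U.Nonempty)
    (hb : Bornology.IsBounded U) : ¬ IsTotallyDisconnected (frontier U) := by
  intro htd
  obtain ⟨z₀, hz₀⟩ := hne
  have hcomp : IsCompact (frontier U) :=
    Metric.isCompact_of_isClosed_isBounded isClosed_frontier
      (hb.closure.subset frontier_subset_closure)
  have : CompactSpace (frontier U) := isCompact_iff_compactSpace.1 hcomp
  have : TotallyDisconnectedSpace (frontier U) := totallyDisconnectedSpace_subtype_iff.2 htd
  have hz₀' : ∀ x : frontier U, (x : ℂ) - z₀ ≠ 0 := fun x hx => by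
    have : (x : ℂ) = z₀ := sub_eq_zero.1 hx
    have hx' : z₀ ∈ frontier U := this ▸ x.2
    rw [hU.frontier_eq] at hx'
    exact hx'.2 hz₀
  obtain ⟨g, hg, hge⟩ := exists_continuous_log_of_totallyDisconnected
    (f := fun x : frontier U => (x : ℂ) - z₀) (by fun_prop) hz₀'
  obtain ⟨G, hG⟩ := ContinuousMap.exists_restrict_eq isClosed_frontier (⟨g, hg⟩ : C(frontier U, ℂ))
  have hGg : ∀ x (hx : x ∈ frontier U), Complex.exp (G x) = x - z₀ := fun x hx => by
    have := DFunLike.congr_fun hG ⟨x, hx⟩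
    simp only [ContinuousMap.restrict_apply, ContinuousMap.coe_mk] at this
    rw [this, hge]
  classical
  -- The gluing is zero-free on the whole plane, so it lifts through `exp`; outside `U` the lift is
  -- a logarithm of `z - z₀`.
  let F : ℂ → ℂ := U.piecewise (fun z => Complex.exp (G z)) (fun z => z - z₀)
  have hF : Continuous F := by
    refine Continuous.piecewise hGg (by fun_prop) (by fun_prop)
  have hF0 : ∀ z, F z ∈ ({0} : Set ℂ)ᶜ := by
    intro z hz
    have hz : F z = 0 := hz
    by_cases hzU : z ∈ U
    · simp [F, hzU] at hz
    · simp only [F, hzU, not_false_eq_true, piecewise_eq_of_notMem, sub_eq_zero] at hz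
      exact hzU (hz ▸ hz₀)
  obtain ⟨L, ⟨-, hLe⟩, -⟩ := Complex.isCoveringMapOn_exp.existsUnique_continuousMap_lifts
    ⟨F, hF⟩ (Complex.exp_log (hF0 0)) hF0
  obtain ⟨R, hR, hUR⟩ := hb.subset_ball_lt 0 z₀
  refine not_exists_continuous_log_circle hR (L := fun z => L (z + z₀))
    (L.continuous.comp (by fun_prop)) fun z hz => ?_
  have hzU : z + z₀ ∉ U := fun h => by simpa [hz] using hUR h
  have := congrFun hLe (z + z₀)
  simpa [F, hzU] using this

/-! ### Logarithms on compact sets that do not separate the plane -/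

/-- `w ↦ w - p` has a continuous logarithm on `K`. -/
def HasLogAt (K : Set ℂ) (p : ℂ) : Prop :=
  ∃ L : ℂ → ℂ, ContinuousOn L K ∧ ∀ w ∈ K, Complex.exp (L w) = w - p

/-- The quotient lies in the unit disc about 1, so its principal logarithm transfers a logarithm
between base points `p` and `q`. -/
theorem div_sub_mem_slitPlane {w p q : ℂ} (h : ‖q - p‖ < ‖w - p‖) :
    (w - q) / (w - p) ∈ Complex.slitPlane ∧ w - p ≠ 0 ∧ w - q ≠ 0 := by
  have h1 : w - p ≠ 0 := fun h0 => by
    rw [h0, norm_zero] at h; exact absurd h (norm_nonneg _).not_gt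
  refine ⟨?_, h1, fun h2 => ?_⟩
  · have : (w - q) / (w - p) = 1 + (p - q) / (w - p) := by field_simp; ring
    rw [this]
    refine Complex.mem_slitPlane_of_norm_lt_one ?_
    rw [norm_div, norm_sub_rev p q]
    exact (div_lt_one (norm_pos_iff.2 h1)).2 h
  · rw [sub_eq_zero.1 h2] at h
    exact h.false

theorem HasLogAt.of_dist_lt {K : Set ℂ} {p q : ℂ} {r : ℝ} (hq : HasLogAt K q)
    (hr : ∀ w ∈ K, r ≤ ‖w - p‖) (hqp : ‖q - p‖ < r) : HasLogAt K p := by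
  obtain ⟨L, hL, hLe⟩ := hq
  have hs : ∀ w ∈ K, (w - q) / (w - p) ∈ Complex.slitPlane ∧ w - p ≠ 0 ∧ w - q ≠ 0 :=
    fun w hw => div_sub_mem_slitPlane (hqp.trans_le (hr w hw))
  refine ⟨fun w => L w - Complex.log ((w - q) / (w - p)), hL.sub ?_, fun w hw => ?_⟩
  · exact ContinuousOn.clog (ContinuousOn.div (by fun_prop) (by fun_prop)
      fun w hw => (hs w hw).2.1) fun w hw => (hs w hw).1
  · obtain ⟨-, h1, h2⟩ := hs w hw
    rw [Complex.exp_sub, hLe w hw, Complex.exp_log (div_ne_zero h2 h1), div_div_cancel₀ h2]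

theorem HasLogAt.of_dist_lt' {K : Set ℂ} {p q : ℂ} {r : ℝ} (hp : HasLogAt K p)
    (hr : ∀ w ∈ K, r ≤ ‖w - p‖) (hqp : ‖q - p‖ < r) : HasLogAt K q := by
  obtain ⟨L, hL, hLe⟩ := hp
  have hs : ∀ w ∈ K, (w - q) / (w - p) ∈ Complex.slitPlane ∧ w - p ≠ 0 ∧ w - q ≠ 0 :=
    fun w hw => div_sub_mem_slitPlane (hqp.trans_le (hr w hw))
  refine ⟨fun w => L w + Complex.log ((w - q) / (w - p)), hL.add ?_, fun w hw => ?_⟩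
  · exact ContinuousOn.clog (ContinuousOn.div (by fun_prop) (by fun_prop)
      fun w hw => (hs w hw).2.1) fun w hw => (hs w hw).1
  · obtain ⟨-, h1, h2⟩ := hs w hw
    rw [Complex.exp_add, hLe w hw, Complex.exp_log (div_ne_zero h2 h1), mul_div_cancel₀ _ h1]

theorem HasLogAt.of_subset_closedBall {K : Set ℂ} {p : ℂ} {R : ℝ} (hK : ∀ w ∈ K, ‖w‖ ≤ R)
    (hp : R < ‖p‖) : HasLogAt K p := by
  by_cases hp0 : p = 0
  · have hem : K = ∅ := eq_empty_of_forall_notMem fun w hw => by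
      have := hK w hw
      rw [hp0, norm_zero] at hp
      exact absurd (norm_nonneg w) (by linarith)
    exact ⟨0, by simp [hem], by simp [hem]⟩
  have hs : ∀ w ∈ K, 1 + -(w / p) ∈ Complex.slitPlane := fun w hw => by
    refine Complex.mem_slitPlane_of_norm_lt_one ?_
    rw [norm_neg, norm_div]
    exact (div_lt_one (norm_pos_iff.2 hp0)).2 ((hK w hw).trans_lt hp)
  refine ⟨fun w => Complex.log (1 + -(w / p)) + Complex.log (-p),
    (ContinuousOn.clog (by fun_prop) hs).add continuousOn_const, fun w hw => ?_⟩
  rw [Complex.exp_add, Complex.exp_log (Complex.slitPlane_ne_zero (hs w hw)),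
    Complex.exp_log (neg_ne_zero.2 hp0)]
  field_simp
  ring

/-- If `g` is a continuous open map, then the compact set `{‖g‖ ≤ R}` does not separate the
plane, so that `w ↦ w - p` has a continuous logarithm on it for every outside point `p`. -/
theorem hasLogAt_of_isOpenMap {g : ℂ → ℂ} (hg : Continuous g) (ho : IsOpenMap g) {R : ℝ}
    (hR : 0 ≤ R) (hK : IsCompact {w | ‖g w‖ ≤ R}) {p : ℂ} (hp : R < ‖g p‖) :
    HasLogAt {w | ‖g w‖ ≤ R} p := by
  set K := {w | ‖g w‖ ≤ R} with hKdef
  by_contra hlog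
  -- `A` is open, relatively closed off `K` and bounded, so `‖g‖` would attain its maximum over
  -- `closure A` inside `A`.
  let A : Set ℂ := {q | q ∉ K ∧ ¬ HasLogAt K q}
  have hfar : ∀ q ∉ K, ∃ r > 0, ∀ w ∈ K, r ≤ ‖w - q‖ := fun q hq => by
    obtain ⟨r, hr, hb⟩ := Metric.isOpen_iff.1 hK.isClosed.isOpen_compl q hq
    refine ⟨r, hr, fun w hw => le_of_not_gt fun h => hb ?_ hw⟩
    rwa [Metric.mem_ball, dist_eq_norm]
  have hAo : IsOpen A := by
    refine Metric.isOpen_iff.2 fun q hq => ?_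
    obtain ⟨r, hr, hw⟩ := hfar q hq.1
    refine ⟨r, hr, fun q' hq' => ?_⟩
    rw [Metric.mem_ball, dist_eq_norm] at hq'
    exact ⟨fun h => (hw q' h).not_gt hq', fun h => hq.2 (h.of_dist_lt hw hq')⟩
  have hAcl : ∀ q ∈ closure A, q ∉ K → q ∈ A := fun q hq hqK => by
    obtain ⟨r, hr, hw⟩ := hfar q hqK
    obtain ⟨q', hq', hd⟩ := Metric.mem_closure_iff.1 hq r hr
    rw [dist_comm, dist_eq_norm] at hd
    exact ⟨hqK, fun h => hq'.2 (h.of_dist_lt' hw hd)⟩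
  obtain ⟨B, hB⟩ := hK.isBounded.exists_norm_le
  have hAb : Bornology.IsBounded A := isBounded_iff_forall_norm_le.2
    ⟨B, fun q hq => le_of_not_gt fun h => hq.2 (HasLogAt.of_subset_closedBall hB h)⟩
  have hpA : p ∈ A := ⟨not_le.2 hp, hlog⟩
  obtain ⟨m, hm, hmax⟩ := hAb.isCompact_closure.exists_isMaxOn ⟨p, subset_closure hpA⟩
    (continuous_norm.comp hg).continuousOn
  have hmp : ‖g p‖ ≤ ‖g m‖ := hmax (subset_closure hpA)
  have hmA : m ∈ A := hAcl m hm (not_le.2 (hp.trans_le hmp))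
  have hpos : 0 < ‖g m‖ := hR.trans_lt (hp.trans_le hmp)
  have hnhds : g '' A ∈ 𝓝 (g m) := (ho A hAo).mem_nhds (mem_image_of_mem g hmA)
  -- Pushing `g m` radially outward stays in `g '' A` and beats the maximum.
  have htend : Tendsto (fun t : ℝ => ((1 + t : ℝ) : ℂ) * g m) (𝓝[>] 0) (𝓝 (g m)) := by
    have : Continuous fun t : ℝ => ((1 + t : ℝ) : ℂ) * g m := by fun_prop
    simpa using (this.tendsto 0).mono_left nhdsWithin_le_nhds
  obtain ⟨t, ⟨x, hxA, hx⟩, ht⟩ := ((htend.eventually hnhds).and self_mem_nhdsWithin).exists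
  have ht : 0 < t := ht
  have hle : ‖g x‖ ≤ ‖g m‖ := hmax (subset_closure hxA)
  rw [hx, norm_mul, Complex.norm_real, Real.norm_eq_abs, abs_of_pos (by linarith)] at hle
  nlinarith

/-! ### Escape and level sets -/

namespace StretchQuad

/-- The map `z ↦ (h z)² + c`, for a real-linear automorphism `h` of the plane. -/
noncomputable def linSq (h : ℂ ≃L[ℝ] ℂ) (c z : ℂ) : ℂ := h z ^ 2 + c

/-- An escape radius for `linSq h c`. -/
noncomputable def escapeRadius (c : ℂ) : ℝ := 3 + ‖c‖

theorem escapeRadius_pos (c : ℂ) : 0 < escapeRadius c := by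
  unfold escapeRadius; positivity

/-- The points whose `n`-th iterate under `linSq h c` lies in the disc of radius `escapeRadius c`. -/
def level (h : ℂ ≃L[ℝ] ℂ) (c : ℂ) (n : ℕ) : Set ℂ :=
  {w | ‖(linSq h c)^[n] w‖ ≤ escapeRadius c}

variable {h : ℂ ≃L[ℝ] ℂ} {c : ℂ}

theorem continuous_linSq : Continuous (linSq h c) := by
  unfold linSq; fun_prop

theorem isOpenMap_linSq : IsOpenMap (linSq h c) := by
  have hsq : IsOpenMap fun z : ℂ => z ^ 2 := by
    have ha : AnalyticOnNhd ℂ (fun z : ℂ => z ^ 2) univ := fun z _ => by fun_prop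
    refine ha.is_constant_or_isOpenMap.resolve_left ?_
    rintro ⟨w, hw⟩
    have := (hw 0).trans (hw 1).symm
    norm_num at this
  exact (Homeomorph.addRight c).isOpenMap.comp (hsq.comp h.toHomeomorph.isOpenMap)

theorem isOpenMap_linSq_iterate (n : ℕ) : IsOpenMap (linSq h c)^[n] := by
  induction n with
  | zero => exact IsOpenMap.id
  | succ n ih => exact ih.comp isOpenMap_linSq

theorem two_mul_norm_le_norm_linSq (hh : ∀ z, ‖z‖ ≤ ‖h z‖) {z : ℂ}
    (hz : escapeRadius c < ‖z‖) : 2 * ‖z‖ ≤ ‖linSq h c z‖ := by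
  have h1 : ‖h z ^ 2‖ ≤ ‖linSq h c z‖ + ‖c‖ := by
    simpa [linSq] using norm_sub_le (linSq h c z) c
  rw [norm_pow] at h1
  have h2 := hh z
  have hc := norm_nonneg c
  unfold escapeRadius at hz
  nlinarith

theorem norm_le_of_norm_linSq_le (hh : ∀ z, ‖z‖ ≤ ‖h z‖) {z : ℂ}
    (hz : ‖linSq h c z‖ ≤ escapeRadius c) : ‖z‖ ≤ escapeRadius c := by
  by_contra! hlt
  have := two_mul_norm_le_norm_linSq hh hlt
  linarith [escapeRadius_pos c]

theorem mem_level_succ {n : ℕ} {z : ℂ} : z ∈ level h c (n + 1) ↔ linSq h c z ∈ level h c n := by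
  simp [level]

theorem level_succ_subset (hh : ∀ z, ‖z‖ ≤ ‖h z‖) (n : ℕ) : level h c (n + 1) ⊆ level h c n := by
  intro z hz
  simp only [level, iterate_succ_apply', mem_ofPred_eq] at hz
  exact norm_le_of_norm_linSq_le hh hz

theorem level_subset_zero (hh : ∀ z, ‖z‖ ≤ ‖h z‖) (n : ℕ) : level h c n ⊆ level h c 0 :=
  antitone_nat_of_succ_le (fun n => level_succ_subset hh n) (Nat.zero_le n)

theorem isCompact_level (hh : ∀ z, ‖z‖ ≤ ‖h z‖) (n : ℕ) : IsCompact (level h c n) := by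
  refine (isCompact_closedBall (0 : ℂ) (escapeRadius c)).of_isClosed_subset
    (isClosed_le (continuous_linSq.iterate n).norm continuous_const) fun z hz => ?_
  simpa [level] using level_subset_zero hh n hz

theorem linSq_eq_const_iff {z : ℂ} : linSq h c z = c ↔ z = 0 := by
  simp [linSq]

/-- The preimage of a connected compact set containing the critical value is connected. -/
theorem isPreconnected_preimage_linSq {K : Set ℂ} (hK : IsPreconnected K) (hcK : c ∈ K)
    (hcomp : IsCompact (linSq h c ⁻¹' K)) : IsPreconnected (linSq h c ⁻¹' K) := by
  set X := linSq h c ⁻¹' K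
  -- The image of `X ∩ b` is clopen in `K`; it misses `c`, whose only preimage 0 lies in `a`, so it
  -- is empty.
  have key : ∀ a b : Set ℂ, IsClosed a → IsClosed b → X ⊆ a ∪ b → Disjoint a b → 0 ∈ a →
      X ⊆ a := by
    intro a b ha hb hab hd h0
    have hB : IsClosed (linSq h c '' (X ∩ b)) :=
      ((hcomp.inter_right hb).image continuous_linSq).isClosed
    have hA : IsOpen (linSq h c '' aᶜ) := isOpenMap_linSq _ ha.isOpen_compl
    have hsub : K ⊆ (linSq h c '' (X ∩ b))ᶜ := by
      refine (isPreconnected_iff_subset_of_disjoint.1 hK _ _ hA hB.isOpen_compl ?_ ?_).resolve_left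
        ?_
      · intro w _
        by_cases hw : w ∈ linSq h c '' (X ∩ b)
        · obtain ⟨x, hx, rfl⟩ := hw
          exact Or.inl ⟨x, fun hxa => hd.le_bot ⟨hxa, hx.2⟩, rfl⟩
        · exact Or.inr hw
      · refine eq_empty_of_forall_notMem ?_
        rintro _ ⟨hwK, ⟨x, hx, rfl⟩, hw⟩
        exact hw ⟨x, ⟨hwK, (hab hwK).resolve_left hx⟩, rfl⟩
      · intro hKA
        obtain ⟨x, hx, hxc⟩ := hKA hcK
        rw [linSq_eq_const_iff] at hxc
        exact hx (hxc ▸ h0)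
    exact fun x hx => (hab hx).resolve_right fun hxb => hsub hx ⟨x, ⟨hx, hxb⟩, rfl⟩
  rw [isPreconnected_iff_subset_of_fully_disjoint_closed hcomp.isClosed]
  intro a b ha hb hab hd
  have h0 : (0 : ℂ) ∈ X := by
    change linSq h c 0 ∈ K
    rwa [linSq_eq_const_iff.2 rfl]
  rcases hab h0 with h0 | h0
  · exact Or.inl (key a b ha hb hab hd h0)
  · exact Or.inr (key b a hb ha (union_comm a b ▸ hab) hd.symm h0)

theorem isPreconnected_level (hh : ∀ z, ‖z‖ ≤ ‖h z‖) {n : ℕ} (hc : ∀ k < n, c ∈ level h c k) :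
    IsPreconnected (level h c n) := by
  induction n with
  | zero =>
    have : level h c 0 = Metric.closedBall 0 (escapeRadius c) := by ext; simp [level]
    rw [this]
    exact (convex_closedBall _ _).isPreconnected
  | succ n ih =>
    have : level h c (n + 1) = linSq h c ⁻¹' level h c n := by ext; exact mem_level_succ
    rw [this]
    exact isPreconnected_preimage_linSq (ih fun k hk => hc k (hk.trans n.lt_succ_self))
      (hc n n.lt_succ_self) (this ▸ isCompact_level hh (n + 1))

theorem two_pow_mul_norm_le (hh : ∀ z, ‖z‖ ≤ ‖h z‖) {z : ℂ} (hz : escapeRadius c < ‖z‖)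
    (n : ℕ) : 2 ^ n * ‖z‖ ≤ ‖(linSq h c)^[n] z‖ := by
  induction n with
  | zero => simp
  | succ n ih =>
    have hlt : escapeRadius c < ‖(linSq h c)^[n] z‖ :=
      (hz.trans_le (le_mul_of_one_le_left (norm_nonneg _) (one_le_pow₀ one_le_two))).trans_le ih
    rw [iterate_succ_apply', pow_succ']
    linarith [two_mul_norm_le_norm_linSq hh hlt]

theorem mem_escapingSet_of_notMem_level (hh : ∀ z, ‖z‖ ≤ ‖h z‖) {z : ℂ} {n : ℕ}
    (hz : z ∉ level h c n) : z ∈ escapingSet (linSq h c) := by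
  have hz : escapeRadius c < ‖(linSq h c)^[n] z‖ := not_le.1 hz
  have hpos := (escapeRadius_pos c).trans hz
  change Tendsto _ _ _
  rw [← tendsto_add_atTop_iff_nat n, ← tendsto_norm_atTop_iff_cobounded]
  refine tendsto_atTop_mono (fun m => ?_)
    ((tendsto_pow_atTop_atTop_of_one_lt one_lt_two).atTop_mul_const hpos)
  rw [iterate_add_apply]
  exact two_pow_mul_norm_le hh hz m

theorem notMem_boundedOrbitSet_of_mem_escapingSet {f : ℂ → ℂ} {z : ℂ} (hz : z ∈ escapingSet f) :
    z ∉ boundedOrbitSet f := by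
  rintro ⟨M, -, hM⟩
  have : Tendsto (fun n : ℕ => ‖f^[n] z‖) atTop atTop := tendsto_norm_atTop_iff_cobounded.2 hz
  obtain ⟨n, hn⟩ := (this.eventually_gt_atTop M).exists
  exact (hM n).not_gt hn

theorem boundedOrbitSet_subset_level (hh : ∀ z, ‖z‖ ≤ ‖h z‖) (n : ℕ) :
    boundedOrbitSet (linSq h c) ⊆ level h c n := fun _ hz => by_contra fun hn =>
  notMem_boundedOrbitSet_of_mem_escapingSet (mem_escapingSet_of_notMem_level hh hn) hz

/-- The offset `N` is harmless: it ignores only finitely many iterates. -/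
theorem mem_boundedOrbitSet_of_forall_level {z : ℂ} {N : ℕ} (hz : ∀ n, z ∈ level h c (N + n)) :
    z ∈ boundedOrbitSet (linSq h c) := by
  obtain ⟨M, hM⟩ := ((finite_lt_nat N).image fun k => ‖(linSq h c)^[k] z‖).bddAbove
  refine ⟨max M (escapeRadius c), lt_max_of_lt_right (escapeRadius_pos c), fun k => ?_⟩
  rcases lt_or_ge k N with hk | hk
  · exact le_max_of_le_left (hM ⟨k, hk, rfl⟩)
  · have := hz (k - N)
    rw [Nat.add_sub_cancel' hk] at this
    exact le_max_of_le_right this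

theorem escapingSet_eq_compl (hh : ∀ z, ‖z‖ ≤ ‖h z‖) :
    escapingSet (linSq h c) = (boundedOrbitSet (linSq h c))ᶜ := by
  refine Subset.antisymm (fun z => notMem_boundedOrbitSet_of_mem_escapingSet) fun z hz => ?_
  by_contra hne
  exact hz (mem_boundedOrbitSet_of_forall_level (N := 0) fun n => not_not.1 fun hn =>
    hne (mem_escapingSet_of_notMem_level hh hn))

/-- If the orbit of `c` is unbounded, some level set is connected, omits `c`, and carries a branch
of the square root of `w - c`. -/
theorem exists_level_sqrt (hh : ∀ z, ‖z‖ ≤ ‖h z‖) (hc : 0 ∉ boundedOrbitSet (linSq h c)) :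
    ∃ N, IsPreconnected (level h c N) ∧ ∃ s : ℂ → ℂ, ContinuousOn s (level h c N) ∧
      ∀ w ∈ level h c N, s w ^ 2 = w - c := by
  have hex : ∃ k, c ∉ level h c k := by
    by_contra! hall
    refine hc (mem_boundedOrbitSet_of_forall_level (N := 1) fun n => ?_)
    rw [add_comm, mem_level_succ, linSq_eq_const_iff.2 rfl]
    exact hall n
  classical
  refine ⟨Nat.find hex, isPreconnected_level hh fun k hk => not_not.1 (Nat.find_min hex hk), ?_⟩
  obtain ⟨L, hL, hLe⟩ := hasLogAt_of_isOpenMap (continuous_linSq.iterate (Nat.find hex))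
    (isOpenMap_linSq_iterate (Nat.find hex)) (escapeRadius_pos c).le
    (isCompact_level hh (Nat.find hex)) (not_le.1 (Nat.find_spec hex))
  refine ⟨fun w => Complex.exp (L w / 2), (hL.div_const 2).cexp, fun w hw => ?_⟩
  rw [← Complex.exp_nat_mul, ← hLe w hw]
  congr 1
  push_cast
  ring

/-! ### Inverse branches, cylinders and itineraries -/

/-- The inverse branches `w ↦ ± h⁻¹ (s w)`. -/
noncomputable def invBranch (h : ℂ ≃L[ℝ] ℂ) (s : ℂ → ℂ) (b : Bool) (w : ℂ) : ℂ :=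
  if b then h.symm (s w) else -h.symm (s w)

/-- The image of `W` under the inverse branches prescribed by the first `m` symbols of `σ`. -/
def cylinder (h : ℂ ≃L[ℝ] ℂ) (s : ℂ → ℂ) (W : Set ℂ) : ℕ → (ℕ → Bool) → Set ℂ
  | 0, _ => W
  | m + 1, σ => invBranch h s (σ 0) '' cylinder h s W m fun k => σ (k + 1)

theorem linSq_invBranch {s : ℂ → ℂ} {w : ℂ} (hs : s w ^ 2 = w - c) (b : Bool) :
    linSq h c (invBranch h s b w) = w := by
  cases b <;> simp [linSq, invBranch, hs]

theorem exists_invBranch_eq {s : ℂ → ℂ} {z : ℂ} (hs : s (linSq h c z) ^ 2 = linSq h c z - c) :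
    ∃ b, invBranch h s b (linSq h c z) = z := by
  have : s (linSq h c z) ^ 2 = h z ^ 2 := by rw [hs, linSq, add_sub_cancel_right]
  rcases sq_eq_sq_iff_eq_or_eq_neg.1 this with h1 | h1
  · exact ⟨true, by simp [invBranch, h1]⟩
  · exact ⟨false, by simp [invBranch, h1]⟩

section Cylinder

variable {s : ℂ → ℂ} {N : ℕ}

theorem cylinder_subset (hs : ∀ w ∈ level h c N, s w ^ 2 = w - c) (hh : ∀ z, ‖z‖ ≤ ‖h z‖)
    (m : ℕ) (σ : ℕ → Bool) : cylinder h s (level h c N) m σ ⊆ level h c (N + m) := by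
  induction m generalizing σ with
  | zero => exact subset_rfl
  | succ m ih =>
    rintro _ ⟨w, hw, rfl⟩
    have hw' := ih _ hw
    have hwN : w ∈ level h c N :=
      antitone_nat_of_succ_le (fun n => level_succ_subset hh n) (Nat.le_add_right N m) hw'
    rw [← add_assoc, mem_level_succ, linSq_invBranch (hs w hwN)]
    exact hw'

theorem cylinder_subset_level (hs : ∀ w ∈ level h c N, s w ^ 2 = w - c)
    (hh : ∀ z, ‖z‖ ≤ ‖h z‖) (m : ℕ) (σ : ℕ → Bool) :
    cylinder h s (level h c N) m σ ⊆ level h c N :=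
  (cylinder_subset hs hh m σ).trans
    (antitone_nat_of_succ_le (fun n => level_succ_subset hh n) (Nat.le_add_right N m))

theorem cylinder_succ_subset (hs : ∀ w ∈ level h c N, s w ^ 2 = w - c) (hh : ∀ z, ‖z‖ ≤ ‖h z‖)
    (m : ℕ) (σ : ℕ → Bool) :
    cylinder h s (level h c N) (m + 1) σ ⊆ cylinder h s (level h c N) m σ := by
  induction m generalizing σ with
  | zero => exact cylinder_subset_level hs hh 1 σ
  | succ m ih => exact image_mono (ih _)

theorem continuousOn_invBranch (hsc : ContinuousOn s (level h c N)) (b : Bool) :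
    ContinuousOn (invBranch h s b) (level h c N) := by
  have := h.symm.continuous.comp_continuousOn hsc
  cases b
  · exact this.neg
  · exact this

theorem isCompact_cylinder (hsc : ContinuousOn s (level h c N))
    (hs : ∀ w ∈ level h c N, s w ^ 2 = w - c) (hh : ∀ z, ‖z‖ ≤ ‖h z‖) (m : ℕ) (σ : ℕ → Bool) :
    IsCompact (cylinder h s (level h c N) m σ) := by
  induction m generalizing σ with
  | zero => exact isCompact_level hh N
  | succ m ih =>
    exact (ih _).image_of_continuousOn
      ((continuousOn_invBranch hsc _).mono (cylinder_subset_level hs hh m _))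

theorem isPreconnected_cylinder (hN : IsPreconnected (level h c N))
    (hsc : ContinuousOn s (level h c N))
    (hs : ∀ w ∈ level h c N, s w ^ 2 = w - c) (hh : ∀ z, ‖z‖ ≤ ‖h z‖) (m : ℕ) (σ : ℕ → Bool) :
    IsPreconnected (cylinder h s (level h c N) m σ) := by
  induction m generalizing σ with
  | zero => exact hN
  | succ m ih =>
    exact (ih _).image _ ((continuousOn_invBranch hsc _).mono (cylinder_subset_level hs hh m _))

/-- The symbolic itinerary of a point. -/
noncomputable def itinerary (h : ℂ ≃L[ℝ] ℂ) (c : ℂ) (s : ℂ → ℂ) (z : ℂ) (k : ℕ) : Bool :=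
  open Classical in
  decide (invBranch h s true (linSq h c ((linSq h c)^[k] z)) = (linSq h c)^[k] z)

theorem invBranch_itinerary {z : ℂ} (hs : s (linSq h c z) ^ 2 = linSq h c z - c) :
    invBranch h s (itinerary h c s z 0) (linSq h c z) = z := by
  by_cases ht : invBranch h s true (linSq h c z) = z
  · simp [itinerary, ht]
  · obtain ⟨b, hb⟩ := exists_invBranch_eq hs
    cases b
    · simpa [itinerary, ht] using hb
    · exact absurd hb ht

theorem mem_cylinder_itinerary (hs : ∀ w ∈ level h c N, s w ^ 2 = w - c)
    (hh : ∀ z, ‖z‖ ≤ ‖h z‖) {z : ℂ} {m : ℕ} (hz : z ∈ level h c (N + m)) :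
    z ∈ cylinder h s (level h c N) m (itinerary h c s z) := by
  induction m generalizing z with
  | zero => exact hz
  | succ m ih =>
    have hz' : linSq h c z ∈ level h c (N + m) := mem_level_succ.1 hz
    refine ⟨linSq h c z, ih hz', invBranch_itinerary (hs _ ?_)⟩
    exact antitone_nat_of_succ_le (fun n => level_succ_subset hh n) (Nat.le_add_right N m) hz'

/-- Points with equal itineraries share every cylinder, and the intersection of these is a connected
subset of the bounded orbit set. -/
theorem itinerary_injOn (hN : IsPreconnected (level h c N)) (hsc : ContinuousOn s (level h c N))
    (hs : ∀ w ∈ level h c N, s w ^ 2 = w - c) (hh : ∀ z, ‖z‖ ≤ ‖h z‖)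
    (htd : IsTotallyDisconnected (boundedOrbitSet (linSq h c))) :
    InjOn (itinerary h c s) (boundedOrbitSet (linSq h c)) := by
  intro z hz w hw hzw
  have hpc := IsPreconnected.iInter_of_antitone_compact
    (antitone_nat_of_succ_le fun m => cylinder_succ_subset hs hh m (itinerary h c s z))
    (fun m => isCompact_cylinder hsc hs hh m _) (fun m => isPreconnected_cylinder hN hsc hs hh m _)
  refine htd _ ?_ hpc (mem_iInter.2 fun m => ?_) (mem_iInter.2 fun m => ?_)
  · exact fun x hx => mem_boundedOrbitSet_of_forall_level fun m =>
      cylinder_subset hs hh m _ (mem_iInter.1 hx m)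
  · exact mem_cylinder_itinerary hs hh (boundedOrbitSet_subset_level hh _ hz)
  · rw [hzw]
    exact mem_cylinder_itinerary hs hh (boundedOrbitSet_subset_level hh _ hw)

end Cylinder

/-! ### Counting periodic points and conclusion -/

theorem mem_boundedOrbitSet_of_isPeriodicPt {f : ℂ → ℂ} {n : ℕ} (hn : 0 < n) {z : ℂ}
    (hz : IsPeriodicPt f n z) : z ∈ boundedOrbitSet f := by
  obtain ⟨M, hM⟩ := ((finite_lt_nat n).image fun k => ‖f^[k] z‖).bddAbove
  refine ⟨max M 1, by positivity, fun k => ?_⟩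
  rw [← hz.iterate_mod_apply]
  exact le_max_of_le_left (hM ⟨k % n, Nat.mod_lt k hn, rfl⟩)

theorem encard_ptsOfPeriod_le (hh : ∀ z, ‖z‖ ≤ ‖h z‖) (hc : 0 ∉ boundedOrbitSet (linSq h c))
    (htd : IsTotallyDisconnected (boundedOrbitSet (linSq h c))) {n : ℕ} (hn : 0 < n) :
    (ptsOfPeriod (linSq h c) n).encard ≤ (2 ^ n : ℕ) := by
  obtain ⟨N, hN, s, hsc, hs⟩ := exists_level_sqrt hh hc
  -- The first `n` symbols determine the whole itinerary of a point of period `n`.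
  have hinj : InjOn (fun z (i : Fin n) => itinerary h c s z i) (ptsOfPeriod (linSq h c) n) := by
    intro z hz w hw hzw
    refine itinerary_injOn hN hsc hs hh htd (mem_boundedOrbitSet_of_isPeriodicPt hn hz)
      (mem_boundedOrbitSet_of_isPeriodicPt hn hw) (funext fun k => ?_)
    have := congrFun hzw ⟨k % n, Nat.mod_lt k hn⟩
    simpa [itinerary, IsPeriodicPt.iterate_mod_apply hz,
      IsPeriodicPt.iterate_mod_apply hw] using this
  rw [← hinj.encard_image]
  refine (encard_le_encard (subset_univ _)).trans ?_
  simp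

theorem isTotallyDisconnected_boundedOrbitSet (hh : ∀ z, ‖z‖ ≤ ‖h z‖)
    (htd : IsTotallyDisconnected (frontier (escapingSet (linSq h c)))) :
    IsTotallyDisconnected (boundedOrbitSet (linSq h c)) := by
  rw [escapingSet_eq_compl hh, frontier_compl] at htd
  have heq : boundedOrbitSet (linSq h c) = ⋂ n, level h c n :=
    Subset.antisymm (subset_iInter fun n => boundedOrbitSet_subset_level hh n) fun z hz =>
      mem_boundedOrbitSet_of_forall_level (N := 0) fun n => mem_iInter.1 hz _
  have hcl : IsClosed (boundedOrbitSet (linSq h c)) := by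
    rw [heq]
    exact isClosed_iInter fun n => (isCompact_level hh n).isClosed
  have hint : interior (boundedOrbitSet (linSq h c)) = ∅ := by
    by_contra hne
    refine not_isTotallyDisconnected_frontier isOpen_interior (nonempty_iff_ne_empty.2 hne)
      (((isCompact_level hh 0).isBounded.subset (boundedOrbitSet_subset_level hh 0)).subset
        interior_subset) fun t ht => htd t (ht.trans frontier_interior_subset)
  rwa [hcl.frontier_eq, hint, sdiff_empty] at htd

/-- The reverse triangle inequality gives the expansion bound, since `(K + 1) / 2 - (K - 1) / 2 =
1`; the bound also forces injectivity. -/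
theorem exists_linSq_eq_H (K θ : ℝ) (c : ℂ) (hK : 1 < K) :
    ∃ h : ℂ ≃L[ℝ] ℂ, (∀ z, ‖z‖ ≤ ‖h z‖) ∧ H K θ c = linSq h c := by
  let T : ℂ →ₗ[ℝ] ℂ := LinearMap.mulLeft ℝ (((K : ℂ) + 1) / 2)
    + LinearMap.mulLeft ℝ (Complex.exp (2 * Complex.I * (θ : ℂ)) * (((K : ℂ) - 1) / 2)) ∘ₗ
      Complex.conjAe.toLinearMap
  have hT : ∀ z, T z = (((K : ℂ) + 1) / 2) * z
    + Complex.exp (2 * Complex.I * (θ : ℂ)) * (((K : ℂ) - 1) / 2) * (starRingEnd ℂ) z :=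
    fun z => rfl
  have hle : ∀ z, ‖z‖ ≤ ‖T z‖ := fun z => by
    have h1 : ‖((K : ℂ) + 1) / 2‖ = (K + 1) / 2 := by
      have : ((K : ℂ) + 1) / 2 = (((K + 1) / 2 : ℝ) : ℂ) := by push_cast; ring
      rw [this, Complex.norm_real, Real.norm_eq_abs, abs_of_pos (by linarith)]
    have h2 : ‖((K : ℂ) - 1) / 2‖ = (K - 1) / 2 := by
      have : ((K : ℂ) - 1) / 2 = (((K - 1) / 2 : ℝ) : ℂ) := by push_cast; ring
      rw [this, Complex.norm_real, Real.norm_eq_abs, abs_of_pos (by linarith)]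
    have h3 : ‖Complex.exp (2 * Complex.I * (θ : ℂ))‖ = 1 := by simp [Complex.norm_exp]
    have := norm_sub_le_norm_add ((((K : ℂ) + 1) / 2) * z)
      (Complex.exp (2 * Complex.I * (θ : ℂ)) * (((K : ℂ) - 1) / 2) * (starRingEnd ℂ) z)
    rw [← hT, norm_mul, norm_mul, norm_mul, h1, h2, h3, RCLike.norm_conj] at this
    linarith
  have hinj : Injective T := (injective_iff_map_eq_zero T).2 fun z hz => by
    simpa [hz] using hle z
  exact ⟨(LinearEquiv.ofInjectiveEndo T hinj).toContinuousLinearEquiv, hle, rfl⟩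

end StretchQuad

/-- `Function.ptsOfPeriod f n` is the set of solutions of `f^[n] z = z`; `n` is not assumed to be the
minimal period. -/
theorem theorem1p3 (K θ : ℝ) (c : ℂ) (hK : 1 < K)
    (hθ : θ ∈ Set.Ioc (-(Real.pi / 2)) (Real.pi / 2))
    (hc : c ∉ StretchQuad.mandelbrotSet K θ)
    (hper : ∃ n : ℕ, 1 ≤ n ∧
      ((2 ^ n + 1 : ℕ) : ℕ∞) ≤ (Function.ptsOfPeriod (StretchQuad.H K θ c) n).encard) :
    ¬ StretchQuad.IsCantorSet (frontier (StretchQuad.escapingSet (StretchQuad.H K θ c))) := by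
  intro hcantor
  have htd := hcantor.isTotallyDisconnected
  obtain ⟨n, hn, hcard⟩ := hper
  obtain ⟨h, hh, heq⟩ := StretchQuad.exists_linSq_eq_H K θ c hK
  change 0 ∉ StretchQuad.boundedOrbitSet (StretchQuad.H K θ c) at hc
  rw [heq] at htd hcard hc
  have := hcard.trans (StretchQuad.encard_ptsOfPeriod_le hh hc
    (StretchQuad.isTotallyDisconnected_boundedOrbitSet hh htd) hn)
  have : 2 ^ n + 1 ≤ 2 ^ n := by exact_mod_cast this
  lia
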